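/- **Setting.** A dueling bandit environment with $K$ arms is a sequence of preference matrices $P_t\in[0,1]^{K\times K}$, $t=1,2,\dots$, with $P_t(a,a')+P_t(a',a)=1$. Put $\delta_t(a,a')=P_t(a,a')-\tfrac12$. For a fixed weight $w=(w^1,\dots,w^K)\in\Delta^K$ (the probability simplex) let $b_t(a,w)=\sum_{a'\in[K]}\delta_t(a,a')\,w^{a'}$ be the weighted Borda score and $\delta_t^{w}(a)=\max_{a'\in[K]}\big(b_t(a',w)-b_t(a,w)\big)$. Arm $a$ has *significant weighted Borda regret* over an interval of rounds $[s_1,s_2]$, $s_1<s_2$, if $$\sum_{s=s_1}^{s_2}\delta_s^{w}(a)\ \ge\ K^{1/3}(s_2-s_1)^{2/3}.$$ For a horizon $T$, the significant winner switches with respect to the known weight $w$ (SKW) are $\tau_0=1$ and, recursively, $\tau_{i+1}$ = the smallest round $t\le T$ with $t>\tau_i$ such that every arm $a\in[K]$ has significant weighted Borda regret over some $[s_1,s_2]\subseteq[\tau_i,t]$ with $s_1<s_2$; if there is no such round, $\tau_{i+1}=T+1$. Let $L$ be the number of SKW phases elapsed in $T$ rounds, i.e. the number of indices $i$ with $\tau_i\le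 T$, and let $$V_T=\sum_{t=2}^{T}\max_{a,a'\in[K]}\big|\delta_t(a,a')-\delta_{t-1}(a,a')\big|$$ be the total variation. **Statement.** Consider the regret bound $B_T(w)=\sum_{i=0}^{L}K^{1/3}(\tau_{i+1}-\tau_i)^{2/3}$ (the term $i=L$ vanishes, since $\tau_i=T+1$ for $i\ge L$). 1. For all $K$, $T$, every environment and every $w\in\Delta^K$, $$B_T(w)\ \le\ K^{1/3}\,T^{2/3}\,L^{1/3}.$$ 2. There is a universal constant $C>0$ such that, for all $K$, $T$, every environment and every $w\in\Delta^K$, $$B_T(w)\ \le\ C\left(V_T^{1/4}\,T^{3/4}\,K^{1/4}+K^{1/3}\,T^{2/3}\right).$$ -/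

import Mathlib

noncomputable section

/-- A non-stationary dueling bandit environment with `K` arms: at round `t` (rounds are numbered
from `1`) arm `a` beats arm `a'` with probability `pref t a a'`. -/
structure DuelingEnv (K : ℕ) where
  pref : ℕ → Fin K → Fin K → ℝ
  pref_nonneg : ∀ t a a', 0 ≤ pref t a a'
  pref_le_one : ∀ t a a', pref t a a' ≤ 1
  pref_add_swap : ∀ t a a', pref t a a' + pref t a' a = 1

namespace DuelingEnv

variable {K : ℕ}

/-- The gap in preferences `δ_t(a, a') = P_t(a, a') - 1/2`. -/
def gap (E : DuelingEnv K) (t : ℕ) (a a' : Fin K) : ℝ := E.pref t a a' - 1 / 2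

/-- The weighted Borda score `b_t(a, w) = ∑_{a'} δ_t(a, a') w^{a'}`. -/
def bordaScore (E : DuelingEnv K) (w : Fin K → ℝ) (t : ℕ) (a : Fin K) : ℝ :=
  ∑ a', E.gap t a a' * w a'

/-- The absolute gap `δ_t^w(a) = max_{a'} (b_t(a', w) - b_t(a, w))` of arm `a`. -/
def bordaGap (E : DuelingEnv K) (w : Fin K → ℝ) (t : ℕ) (a : Fin K) : ℝ :=
  ⨆ a', (E.bordaScore w t a' - E.bordaScore w t a)

/-- Arm `a` has significant weighted Borda regret over the interval of rounds `[s₁, s₂]`. -/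
def SignificantRegret (E : DuelingEnv K) (w : Fin K → ℝ) (a : Fin K) (s₁ s₂ : ℕ) : Prop :=
  (K : ℝ) ^ (1 / 3 : ℝ) * ((s₂ : ℝ) - (s₁ : ℝ)) ^ (2 / 3 : ℝ)
    ≤ ∑ s ∈ Finset.Icc s₁ s₂, E.bordaGap w s a

/-- Every arm has significant weighted Borda regret over some subinterval `[s₁, s₂]`, `s₁ < s₂`,
of `[start, t]`. (On a one-round interval the threshold is `0`, so these are not considered.) -/
def AllArmsSignificant (E : DuelingEnv K) (w : Fin K → ℝ) (start t : ℕ) : Prop :=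
  ∀ a, ∃ s₁ s₂, start ≤ s₁ ∧ s₁ < s₂ ∧ s₂ ≤ t ∧ E.SignificantRegret w a s₁ s₂

/-- The significant winner switches with respect to the known weight `w` (SKW) up to the horizon
`T`: `τ_0 = 1`, and `τ_{i+1}` is the smallest round `t > τ_i` among the `T` rounds such that every
arm has significant regret inside `[τ_i, t]`, and `T + 1` if there is no such round. -/
def skw (E : DuelingEnv K) (w : Fin K → ℝ) (T : ℕ) : ℕ → ℕ
  | 0 => 1
  | i + 1 =>
    sInf ({t | skw E w T i < t ∧ t ≤ T ∧ E.AllArmsSignificant w (skw E w T i) t} ∪ {T + 1})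

/-- The number of SKW phases `[τ_i, τ_{i+1})` elapsed in `T` rounds, that is, of the phases that
start at a round `τ_i ≤ T`. -/
def numPhases (E : DuelingEnv K) (w : Fin K → ℝ) (T : ℕ) : ℕ :=
  {i : ℕ | E.skw w T i ≤ T}.ncard

/-- `∑_{i=0}^{L} K^{1/3} (τ_{i+1} - τ_i)^{2/3}`. The term `i = L` is zero, as `τ_i = T + 1` for
every `i ≥ L` when `1 ≤ T`. -/
def skwBound (E : DuelingEnv K) (w : Fin K → ℝ) (T : ℕ) : ℝ :=
  ∑ i ∈ Finset.range (E.numPhases w T + 1),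
    (K : ℝ) ^ (1 / 3 : ℝ) * ((E.skw w T (i + 1) : ℝ) - (E.skw w T i : ℝ)) ^ (2 / 3 : ℝ)

/-- The total variation `V_T = ∑_{t=2}^T max_{a, a'} |δ_t(a, a') - δ_{t-1}(a, a')|`. -/
def totalVariation (E : DuelingEnv K) (T : ℕ) : ℝ :=
  ∑ t ∈ Finset.Icc 2 T, ⨆ p : Fin K × Fin K, |E.gap t p.1 p.2 - E.gap (t - 1) p.1 p.2|

end DuelingEnv

end

namespace DuelingEnv

open Finset

variable {K : ℕ} (E : DuelingEnv K) (w : Fin K → ℝ) (T : ℕ)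

/-! Part 1 is Hölder applied to the phase lengths, which sum to at most `T`. For part 2, let a
completed phase have length `l` and variation `S`. The arm that is optimal at its last round has gap
at most `2 * S` throughout the phase, yet it has significant regret on a subinterval; this forces
`K^(1/3) ≤ 4 * l^(1/3) * S` (`AllArmsSignificant.rpow_le_mul_sum`). Hence the phase costs at most
`(4 * S)^(1/4) * (K * l^3)^(1/4)`, and Hölder with exponents `1/4`, `3/4` sums these costs
(`sum_completed_phases_le`). The last phase, which no switch need end, costs at most `K^(1/3) *
T^(2/3)`. -/

/-- The variation of the preferences between the rounds `t - 1` and `t`. -/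
noncomputable def roundVariation (t : ℕ) : ℝ :=
  ⨆ p : Fin K × Fin K, |E.gap t p.1 p.2 - E.gap (t - 1) p.1 p.2|

theorem roundVariation_nonneg (t : ℕ) : 0 ≤ E.roundVariation t :=
  Real.iSup_nonneg fun _ => abs_nonneg _

theorem abs_gap_sub_le_roundVariation (t : ℕ) (a a' : Fin K) :
    |E.gap t a a' - E.gap (t - 1) a a'| ≤ E.roundVariation t :=
  le_ciSup (f := fun p : Fin K × Fin K => |E.gap t p.1 p.2 - E.gap (t - 1) p.1 p.2|)
    (Set.finite_range _).bddAbove (a, a')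

theorem abs_gap_sub_le_sum {s n : ℕ} (h : s ≤ n) (a a' : Fin K) :
    |E.gap n a a' - E.gap s a a'| ≤ ∑ t ∈ Ioc s n, E.roundVariation t := by
  induction n, h using Nat.le_induction with
  | base => simp
  | succ n hn ih =>
    rw [← Finset.sum_Ioc_consecutive _ hn n.le_succ, Nat.Ioc_succ_singleton, sum_singleton]
    have h := E.abs_gap_sub_le_roundVariation (n + 1) a a'
    rw [Nat.add_sub_cancel] at h
    calc |E.gap (n + 1) a a' - E.gap s a a'|
        ≤ |E.gap (n + 1) a a' - E.gap n a a'| + |E.gap n a a' - E.gap s a a'| :=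
          abs_sub_le _ _ _
      _ ≤ _ := by linarith

variable {w}

/-- The score is a convex combination of gaps, so no factor `K` is lost. -/
theorem abs_bordaScore_sub_le_sum (hw : w ∈ stdSimplex ℝ (Fin K)) {s n : ℕ} (h : s ≤ n)
    (a : Fin K) :
    |E.bordaScore w n a - E.bordaScore w s a| ≤ ∑ t ∈ Ioc s n, E.roundVariation t := by
  unfold bordaScore
  rw [← Finset.sum_sub_distrib]
  calc |∑ a', (E.gap n a a' * w a' - E.gap s a a' * w a')|
      ≤ ∑ a', |E.gap n a a' * w a' - E.gap s a a' * w a'| := Finset.abs_sum_le_sum_abs _ _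
    _ ≤ ∑ a', (∑ t ∈ Ioc s n, E.roundVariation t) * w a' := by
        refine Finset.sum_le_sum fun a' _ => ?_
        rw [← sub_mul, abs_mul, abs_of_nonneg (hw.1 a')]
        exact mul_le_mul_of_nonneg_right (E.abs_gap_sub_le_sum h a a') (hw.1 a')
    _ = ∑ t ∈ Ioc s n, E.roundVariation t := by rw [← Finset.mul_sum, hw.2, mul_one]

/-- An arm that is optimal at round `n` has a small gap at the earlier rounds. -/
theorem exists_forall_bordaGap_le [Nonempty (Fin K)] (hw : w ∈ stdSimplex ℝ (Fin K)) (n : ℕ) :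
    ∃ a, ∀ s ≤ n, E.bordaGap w s a ≤ 2 * ∑ t ∈ Ioc s n, E.roundVariation t := by
  obtain ⟨a, ha⟩ := Finite.exists_max (E.bordaScore w n)
  refine ⟨a, fun s hs => ciSup_le fun a' => ?_⟩
  have h₁ := abs_le.1 (E.abs_bordaScore_sub_le_sum hw hs a)
  have h₂ := abs_le.1 (E.abs_bordaScore_sub_le_sum hw hs a')
  linarith [ha a', h₁.2, h₂.1]

theorem AllArmsSignificant.rpow_le_mul_sum {E : DuelingEnv K} [Nonempty (Fin K)]
    (hw : w ∈ stdSimplex ℝ (Fin K)) {m n : ℕ} (h : E.AllArmsSignificant w m n) :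
    (K : ℝ) ^ (1 / 3 : ℝ)
      ≤ 4 * ((n : ℝ) - m) ^ (1 / 3 : ℝ) * ∑ t ∈ Ioc m n, E.roundVariation t := by
  obtain ⟨a, ha⟩ := E.exists_forall_bordaGap_le hw n
  obtain ⟨s₁, s₂, h₁, h₁₂, h₂, hs⟩ := h a
  set S := ∑ t ∈ Ioc m n, E.roundVariation t with hS
  have hS₀ : 0 ≤ S := Finset.sum_nonneg fun t _ => E.roundVariation_nonneg t
  have hgap : ∑ s ∈ Icc s₁ s₂, E.bordaGap w s a ≤ ((s₂ : ℝ) - s₁ + 1) * (2 * S) := by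
    have hb : ∀ s ∈ Icc s₁ s₂, E.bordaGap w s a ≤ 2 * S := fun s hs => by
      rw [Finset.mem_Icc] at hs
      refine (ha s (hs.2.trans h₂)).trans ?_
      have : ∑ t ∈ Ioc s n, E.roundVariation t ≤ S :=
        Finset.sum_le_sum_of_subset_of_nonneg (Finset.Ioc_subset_Ioc_left (h₁.trans hs.1))
          fun t _ _ => E.roundVariation_nonneg t
      linarith
    refine (Finset.sum_le_card_nsmul _ _ _ hb).trans_eq ?_
    rw [nsmul_eq_mul, Nat.card_Icc, Nat.cast_sub (by omega)]
    push_cast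
    ring
  have hd : (1 : ℝ) ≤ (s₂ : ℝ) - s₁ := by
    have : (s₁ : ℝ) + 1 ≤ s₂ := by exact_mod_cast h₁₂
    linarith
  have hdn : (s₂ : ℝ) - s₁ ≤ (n : ℝ) - m := by
    have h₁' : (m : ℝ) ≤ s₁ := by exact_mod_cast h₁
    have h₂' : (s₂ : ℝ) ≤ n := by exact_mod_cast h₂
    linarith
  unfold SignificantRegret at hs
  set d : ℝ := (s₂ : ℝ) - s₁
  have hd₀ : 0 < d := by linarith
  have hsplit : d = d ^ (1 / 3 : ℝ) * d ^ (2 / 3 : ℝ) := by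
    rw [← Real.rpow_add hd₀]
    norm_num
  have hkey : (K : ℝ) ^ (1 / 3 : ℝ) * d ^ (2 / 3 : ℝ)
      ≤ 4 * d ^ (1 / 3 : ℝ) * S * d ^ (2 / 3 : ℝ) := by
    calc _ ≤ (d + 1) * (2 * S) := hs.trans hgap
      -- Uses `1 ≤ d`: one-round intervals are excluded by `s₁ < s₂`.
      _ ≤ (d + d) * (2 * S) := by gcongr
      _ = 4 * S * d := by ring
      _ = 4 * S * (d ^ (1 / 3 : ℝ) * d ^ (2 / 3 : ℝ)) := by rw [← hsplit]
      _ = _ := by ring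
  refine (le_of_mul_le_mul_right hkey (by positivity)).trans ?_
  gcongr

/-- The regret bound of a phase in terms of the variation in it. -/
theorem AllArmsSignificant.rpow_mul_rpow_le {E : DuelingEnv K} [Nonempty (Fin K)]
    (hw : w ∈ stdSimplex ℝ (Fin K)) {m n : ℕ} (hmn : m < n) (h : E.AllArmsSignificant w m n) :
    (K : ℝ) ^ (1 / 3 : ℝ) * ((n : ℝ) - m) ^ (2 / 3 : ℝ)
      ≤ (4 * ∑ t ∈ Ioc m n, E.roundVariation t) ^ (1 / 4 : ℝ)
        * (K * ((n : ℝ) - m) ^ (3 : ℝ)) ^ (1 / 4 : ℝ) := by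
  have hS₀ : 0 ≤ ∑ t ∈ Ioc m n, E.roundVariation t :=
    Finset.sum_nonneg fun t _ => E.roundVariation_nonneg t
  have hl : (0 : ℝ) < (n : ℝ) - m := sub_pos.2 (by exact_mod_cast hmn)
  have hK : (0 : ℝ) < K := by exact_mod_cast Fin.pos_iff_nonempty.2 ‹_›
  have hv := h.rpow_le_mul_sum hw
  set S := ∑ t ∈ Ioc m n, E.roundVariation t
  set l : ℝ := (n : ℝ) - m
  -- Compare fourth powers: `K^(4/3) * l^(8/3)` has a spare factor `K^(1/3)`, to which the previous
  -- lemma applies.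
  rw [← Real.mul_rpow (by positivity) (by positivity),
    show (K : ℝ) ^ (1 / 3 : ℝ) * l ^ (2 / 3 : ℝ)
      = (K ^ (1 / 3 : ℝ) * (K * l ^ (8 / 3 : ℝ))) ^ (1 / 4 : ℝ) by
        rw [← mul_assoc, Real.mul_rpow (by positivity) (by positivity), ← Real.rpow_add_one hK.ne',
          ← Real.rpow_mul hK.le, ← Real.rpow_mul hl.le]
        norm_num]
  refine Real.rpow_le_rpow (by positivity) ?_ (by norm_num)
  calc (K : ℝ) ^ (1 / 3 : ℝ) * (K * l ^ (8 / 3 : ℝ))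
      ≤ (4 * l ^ (1 / 3 : ℝ) * S) * (K * l ^ (8 / 3 : ℝ)) := by gcongr
    _ = 4 * S * (K * (l ^ (1 / 3 : ℝ) * l ^ (8 / 3 : ℝ))) := by ring
    _ = 4 * S * (K * l ^ (3 : ℝ)) := by rw [← Real.rpow_add hl]; norm_num

/-! ### Structure of the switch times -/

variable (w)

theorem skw_succ_mem (i : ℕ) :
    E.skw w T (i + 1) ∈
      {t | E.skw w T i < t ∧ t ≤ T ∧ E.AllArmsSignificant w (E.skw w T i) t} ∪ {T + 1} := by
  rw [skw]
  -- The element `T + 1` keeps `sInf` from being the default `0` of an empty set.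
  exact Nat.sInf_mem ⟨T + 1, Or.inr rfl⟩

theorem skw_le_add_one (i : ℕ) : E.skw w T i ≤ T + 1 := by
  cases i with
  | zero => simp [skw]
  | succ i =>
    rcases E.skw_succ_mem w T i with h | h
    · exact h.2.1.trans T.le_succ
    · exact h.le

theorem skw_mono : Monotone (E.skw w T) := by
  refine monotone_nat_of_le_succ fun i => ?_
  rcases E.skw_succ_mem w T i with h | h
  · exact h.1.le
  · exact (E.skw_le_add_one w T i).trans_eq h.symm

theorem one_le_skw (i : ℕ) : 1 ≤ E.skw w T i :=
  (show 1 ≤ E.skw w T 0 by simp [skw]).trans (E.skw_mono w T i.zero_le)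

theorem skw_lt_skw_succ {i : ℕ} (hi : E.skw w T i ≤ T) : E.skw w T i < E.skw w T (i + 1) := by
  rcases E.skw_succ_mem w T i with h | h
  · exact h.1
  · rw [Set.mem_singleton_iff.1 h]
    omega

theorem allArmsSignificant_skw {i : ℕ} (hi : E.skw w T (i + 1) ≤ T) :
    E.AllArmsSignificant w (E.skw w T i) (E.skw w T (i + 1)) := by
  rcases E.skw_succ_mem w T i with h | h
  · exact h.2.2
  · rw [Set.mem_singleton_iff.1 h] at hi
    omega

theorem exists_lt_skw : ∃ i, T < E.skw w T i := by
  by_contra! h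
  have hm : StrictMono (E.skw w T) :=
    strictMono_nat_of_lt_succ fun i => E.skw_lt_skw_succ w T (h i)
  have := hm.le_apply (x := T + 1)
  exact absurd (h (T + 1)) (by omega)

/-- By monotonicity the indices counted form an initial segment, finite by `exists_lt_skw`. -/
theorem skw_le_iff_lt_numPhases {i : ℕ} : E.skw w T i ≤ T ↔ i < E.numPhases w T := by
  classical
  have h : ∀ j, E.skw w T j ≤ T ↔ j < Nat.find (E.exists_lt_skw w T) := fun j => by
    rw [Nat.lt_find_iff]
    exact ⟨fun hj m hm => not_lt.2 ((E.skw_mono w T hm).trans hj), fun hj => not_lt.1 (hj j le_rfl)⟩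
  have hn : E.numPhases w T = Nat.find (E.exists_lt_skw w T) := by
    rw [numPhases, show {i | E.skw w T i ≤ T} = ↑(Finset.range (Nat.find (E.exists_lt_skw w T)))
      from Set.ext fun j => by rw [Finset.coe_range, Set.mem_Iio]; exact h j, Set.ncard_coe_finset, Finset.card_range]
  rw [hn, h]

theorem skw_of_numPhases_le {i : ℕ} (hi : E.numPhases w T ≤ i) : E.skw w T i = T + 1 := by
  have h := (E.skw_le_iff_lt_numPhases w T (i := i)).not.2 (by omega)
  have := E.skw_le_add_one w T i
  omega

theorem skwBound_eq_sum_range_numPhases :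
    E.skwBound w T = (K : ℝ) ^ (1 / 3 : ℝ) * ∑ i ∈ range (E.numPhases w T),
      ((E.skw w T (i + 1) : ℝ) - E.skw w T i) ^ (2 / 3 : ℝ) := by
  rw [skwBound, Finset.sum_range_succ, E.skw_of_numPhases_le w T le_rfl,
    E.skw_of_numPhases_le w T (Nat.le_succ _), sub_self, Real.zero_rpow (by norm_num), mul_zero,
    add_zero, Finset.mul_sum]

theorem skw_succ_sub_nonneg (i : ℕ) : (0 : ℝ) ≤ (E.skw w T (i + 1) : ℝ) - E.skw w T i :=
  sub_nonneg.2 (by exact_mod_cast E.skw_mono w T i.le_succ)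

theorem sum_skw_succ_sub_le (n : ℕ) :
    ∑ i ∈ range n, ((E.skw w T (i + 1) : ℝ) - E.skw w T i) ≤ T := by
  rw [Finset.sum_range_sub fun i => (E.skw w T i : ℝ)]
  have h₁ : (E.skw w T n : ℝ) ≤ T + 1 := by exact_mod_cast E.skw_le_add_one w T n
  have h₀ : E.skw w T 0 = 1 := by simp [skw]
  rw [h₀]
  push_cast
  linarith

/-- Half-open phases tile `(1, τ_n]` without overlap; `hn` keeps out round `T + 1`, which
`totalVariation` does not count. -/
theorem sum_sum_roundVariation_le {n : ℕ} (hn : E.skw w T n ≤ T) :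
    ∑ i ∈ range n, ∑ t ∈ Ioc (E.skw w T i) (E.skw w T (i + 1)), E.roundVariation t
      ≤ E.totalVariation T := by
  have h : ∀ n, ∑ i ∈ range n, ∑ t ∈ Ioc (E.skw w T i) (E.skw w T (i + 1)), E.roundVariation t
      = ∑ t ∈ Ioc 1 (E.skw w T n), E.roundVariation t := fun n => by
    induction n with
    | zero => simp [skw]
    | succ n ih =>
      rw [Finset.sum_range_succ, ih,
        Finset.sum_Ioc_consecutive _ (E.one_le_skw w T n) (E.skw_mono w T n.le_succ)]
  rw [h]
  refine Finset.sum_le_sum_of_subset_of_nonneg (fun t ht => ?_)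
    fun t _ _ => E.roundVariation_nonneg t
  rw [Finset.mem_Ioc] at ht
  rw [Finset.mem_Icc]
  omega

end DuelingEnv

/-! ### Summation over phases -/

/-- Hölder's inequality for a geometric mean of two nonnegative families. -/
theorem Real.sum_rpow_mul_rpow_le {ι : Type*} (s : Finset ι) {f g : ι → ℝ} {p q : ℝ}
    (hp : 0 < p) (hq : 0 < q) (hpq : p + q = 1) (hf : ∀ i ∈ s, 0 ≤ f i) (hg : ∀ i ∈ s, 0 ≤ g i) :
    ∑ i ∈ s, f i ^ p * g i ^ q ≤ (∑ i ∈ s, f i) ^ p * (∑ i ∈ s, g i) ^ q := by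
  have hc : p⁻¹.HolderConjugate q⁻¹ :=
    Real.holderConjugate_iff.2 ⟨(one_lt_inv₀ hp).2 (by linarith), by simpa using hpq⟩
  have h := Real.inner_le_Lp_mul_Lq_of_nonneg s hc (fun i hi => Real.rpow_nonneg (hf i hi) p)
    fun i hi => Real.rpow_nonneg (hg i hi) q
  rwa [one_div, inv_inv, one_div, inv_inv,
    Finset.sum_congr rfl fun i hi => Real.rpow_rpow_inv (hf i hi) hp.ne',
    Finset.sum_congr rfl fun i hi => Real.rpow_rpow_inv (hg i hi) hq.ne'] at h

namespace DuelingEnv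

open Finset

variable {K : ℕ} (E : DuelingEnv K) (w : Fin K → ℝ) (T : ℕ)

theorem skwBound_le_numPhases :
    E.skwBound w T ≤ (K : ℝ) ^ (1 / 3 : ℝ) * (T : ℝ) ^ (2 / 3 : ℝ)
      * (E.numPhases w T : ℝ) ^ (1 / 3 : ℝ) := by
  have h := Real.sum_rpow_mul_rpow_le (range (E.numPhases w T))
    (f := fun i => (E.skw w T (i + 1) : ℝ) - E.skw w T i) (g := fun _ => 1)
    (p := 2 / 3) (q := 1 / 3) (by norm_num) (by norm_num) (by norm_num)
    (fun i _ => E.skw_succ_sub_nonneg w T i) fun _ _ => zero_le_one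
  simp only [Real.one_rpow, mul_one, sum_const, card_range, nsmul_eq_mul] at h
  rw [skwBound_eq_sum_range_numPhases, mul_assoc]
  refine mul_le_mul_of_nonneg_left (h.trans ?_) (by positivity)
  refine mul_le_mul_of_nonneg_right ?_ (by positivity)
  exact Real.rpow_le_rpow (Finset.sum_nonneg fun i _ => E.skw_succ_sub_nonneg w T i)
    (E.sum_skw_succ_sub_le w T _) (by norm_num)

variable {w}

/-- The bound on the phases that end with a significant winner switch. -/
theorem sum_completed_phases_le [Nonempty (Fin K)] (hw : w ∈ stdSimplex ℝ (Fin K)) {n : ℕ}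
    (hn : E.skw w T n ≤ T) :
    ∑ i ∈ range n, (K : ℝ) ^ (1 / 3 : ℝ) *
        ((E.skw w T (i + 1) : ℝ) - E.skw w T i) ^ (2 / 3 : ℝ)
      ≤ 2 * ((E.totalVariation T) ^ (1 / 4 : ℝ) * (T : ℝ) ^ (3 / 4 : ℝ)
          * (K : ℝ) ^ (1 / 4 : ℝ)) := by
  set l : ℕ → ℝ := fun i => (E.skw w T (i + 1) : ℝ) - E.skw w T i
  set S : ℕ → ℝ := fun i => ∑ t ∈ Ioc (E.skw w T i) (E.skw w T (i + 1)), E.roundVariation t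
  have hl : ∀ i, 0 ≤ l i := E.skw_succ_sub_nonneg w T
  have hS : ∀ i, 0 ≤ S i := fun i => Finset.sum_nonneg fun t _ => E.roundVariation_nonneg t
  have hV : ∑ i ∈ range n, S i ≤ E.totalVariation T := E.sum_sum_roundVariation_le w T hn
  have hV₀ : 0 ≤ E.totalVariation T := (Finset.sum_nonneg fun i _ => hS i).trans hV
  have hphase : ∀ i ∈ range n, (K : ℝ) ^ (1 / 3 : ℝ) * l i ^ (2 / 3 : ℝ)
      ≤ (4 * K : ℝ) ^ (1 / 4 : ℝ) * (S i ^ (1 / 4 : ℝ) * l i ^ (3 / 4 : ℝ)) := fun i hi => by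
    have hi' := (E.skw_mono w T (Nat.succ_le_of_lt (Finset.mem_range.1 hi))).trans hn
    have h := (E.allArmsSignificant_skw w T hi').rpow_mul_rpow_le hw
      (E.skw_lt_skw_succ w T ((E.skw_mono w T i.le_succ).trans hi'))
    refine h.trans_eq ?_
    change (4 * S i) ^ (1 / 4 : ℝ) * (K * l i ^ (3 : ℝ)) ^ (1 / 4 : ℝ) = _
    rw [Real.mul_rpow (by norm_num) (hS i), Real.mul_rpow (by positivity) (Real.rpow_nonneg (hl i) _),
      Real.mul_rpow (by norm_num) (by positivity), ← Real.rpow_mul (hl i)]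
    norm_num
    ring
  have hfour : (4 : ℝ) ^ (1 / 4 : ℝ) ≤ 2 := by
    rw [show (4 : ℝ) = 2 ^ (2 : ℝ) by norm_num, ← Real.rpow_mul (by norm_num)]
    exact (Real.rpow_le_rpow_of_exponent_le one_le_two (by norm_num)).trans_eq (Real.rpow_one 2)
  calc ∑ i ∈ range n, (K : ℝ) ^ (1 / 3 : ℝ) * l i ^ (2 / 3 : ℝ)
      ≤ (4 * K : ℝ) ^ (1 / 4 : ℝ) * ∑ i ∈ range n, S i ^ (1 / 4 : ℝ) * l i ^ (3 / 4 : ℝ) := by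
        rw [Finset.mul_sum]
        exact Finset.sum_le_sum hphase
    _ ≤ (4 * K : ℝ) ^ (1 / 4 : ℝ) *
        ((∑ i ∈ range n, S i) ^ (1 / 4 : ℝ) * (∑ i ∈ range n, l i) ^ (3 / 4 : ℝ)) := by
        refine mul_le_mul_of_nonneg_left ?_ (by positivity)
        exact Real.sum_rpow_mul_rpow_le _ (by norm_num) (by norm_num) (by norm_num)
          (fun i _ => hS i) fun i _ => hl i
    _ ≤ (4 * K : ℝ) ^ (1 / 4 : ℝ) *
        ((E.totalVariation T) ^ (1 / 4 : ℝ) * (T : ℝ) ^ (3 / 4 : ℝ)) := by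
        refine mul_le_mul_of_nonneg_left (mul_le_mul ?_ ?_ ?_ ?_) (by positivity)
        · exact Real.rpow_le_rpow (Finset.sum_nonneg fun i _ => hS i) hV (by norm_num)
        · exact Real.rpow_le_rpow (Finset.sum_nonneg fun i _ => hl i)
            (E.sum_skw_succ_sub_le w T n) (by norm_num)
        · exact Real.rpow_nonneg (Finset.sum_nonneg fun i _ => hl i) _
        · exact Real.rpow_nonneg hV₀ _
    _ = 4 ^ (1 / 4 : ℝ) * ((E.totalVariation T) ^ (1 / 4 : ℝ) * (T : ℝ) ^ (3 / 4 : ℝ)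
          * (K : ℝ) ^ (1 / 4 : ℝ)) := by
        rw [Real.mul_rpow (by norm_num) (by positivity)]
        ring
    _ ≤ _ := by gcongr

theorem skwBound_le_totalVariation (hw : w ∈ stdSimplex ℝ (Fin K)) :
    E.skwBound w T
      ≤ 2 * ((E.totalVariation T) ^ (1 / 4 : ℝ) * (T : ℝ) ^ (3 / 4 : ℝ) * (K : ℝ) ^ (1 / 4 : ℝ)
          + (K : ℝ) ^ (1 / 3 : ℝ) * (T : ℝ) ^ (2 / 3 : ℝ)) := by
  have : Nonempty (Fin K) := by
    by_contra h
    rw [not_nonempty_iff] at h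
    simpa using hw.2
  have hV₀ : 0 ≤ E.totalVariation T := Finset.sum_nonneg fun t _ => E.roundVariation_nonneg t
  rw [skwBound_eq_sum_range_numPhases, Finset.mul_sum]
  rcases hL : E.numPhases w T with _ | n
  -- No phase at all: this happens only for `T = 0`, since `τ_0 = 1`.
  · simp only [range_zero, sum_empty]
    positivity
  · have hn : E.skw w T n ≤ T := (E.skw_le_iff_lt_numPhases w T).2 (by omega)
    have hlast : (K : ℝ) ^ (1 / 3 : ℝ) *
        ((E.skw w T (n + 1) : ℝ) - E.skw w T n) ^ (2 / 3 : ℝ)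
        ≤ (K : ℝ) ^ (1 / 3 : ℝ) * (T : ℝ) ^ (2 / 3 : ℝ) := by
      refine mul_le_mul_of_nonneg_left ?_ (by positivity)
      refine Real.rpow_le_rpow (E.skw_succ_sub_nonneg w T n) ?_ (by norm_num)
      exact (Finset.single_le_sum (fun i _ => E.skw_succ_sub_nonneg w T i)
        (Finset.self_mem_range_succ n)).trans (E.sum_skw_succ_sub_le w T (n + 1))
    have hrest : 0 ≤ (K : ℝ) ^ (1 / 3 : ℝ) * (T : ℝ) ^ (2 / 3 : ℝ) := by positivity
    rw [Finset.sum_range_succ, mul_add]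
    linarith [E.sum_completed_phases_le T hw hn]

end DuelingEnv

theorem mainTheorem4 :
    (∀ (K T : ℕ) (E : DuelingEnv K) (w : Fin K → ℝ), w ∈ stdSimplex ℝ (Fin K) →
      E.skwBound w T
        ≤ (K : ℝ) ^ (1 / 3 : ℝ) * (T : ℝ) ^ (2 / 3 : ℝ)
            * (E.numPhases w T : ℝ) ^ (1 / 3 : ℝ)) ∧
    (∃ C : ℝ, 0 < C ∧
      ∀ (K T : ℕ) (E : DuelingEnv K) (w : Fin K → ℝ), w ∈ stdSimplex ℝ (Fin K) →
        E.skwBound w T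
          ≤ C * ((E.totalVariation T) ^ (1 / 4 : ℝ) * (T : ℝ) ^ (3 / 4 : ℝ)
                * (K : ℝ) ^ (1 / 4 : ℝ)
              + (K : ℝ) ^ (1 / 3 : ℝ) * (T : ℝ) ^ (2 / 3 : ℝ))) := by
  exact ⟨fun _ T E w _ => E.skwBound_le_numPhases w T,
    2, two_pos, fun _ T E _ hw => E.skwBound_le_totalVariation T hw⟩
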